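/- Algebras are nonempty. A \emph{quasivariety} is a class $\mathsf K$ of similar algebras, in a language $\mathcal L_{\mathsf K}$, closed under isomorphic copies, subalgebras, direct products (including the empty product) and ultraproducts. An $n$-ary \emph{operation} of $\mathsf K$ is a family $f=\langle f^{A} : A\in\mathsf K\rangle$ of partial functions $f^A\colon \mathrm{dom}(f^A)\to A$ with $\mathrm{dom}(f^A)\subseteq A^n$ that is globally preserved by homomorphisms: if $h\colon A\to B$ is a homomorphism between members of $\mathsf K$ and $\vec a\in \mathrm{dom}(f^A)$, then $h(\vec a)\in\mathrm{dom}(f^B)$ and $h(f^A(\vec a))=f^B(h(\vec a))$. A formula $\varphi(x_1,\dots,x_n,y)$ \emph{defines} $f$ when for all $A\in\mathsf K$ and $\vec a,b$ in $A$ we have $A\vDash\varphi(\vec a,b)$ iff $\vec a\in\mathrm{dom}(f^A)$ and $f^A(\vec a)=b$; for $n\ge 1$, $f$ is \emph{implicit} when it is defined by some first order formula. A \emph{pp formula} is an existentially quantified finite conjunction of equations. An implicit operation $f$ is \emph{extendable} when for all $A\in\mathsf K$ and $\vec a\in A^n$ there is $B\in\mathsf K$ extending $A$ with $\vec a\in\mathrm{dom}(f^B)$.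 Let $\mathsf{ext}_{pp}(\mathsf K)$ be the class of extendable implicit operations of $\mathsf K$ that can be defined by a pp formula. Let $\mathcal F$ be a family of (not necessarily distinct) members of $\mathsf{ext}_{pp}(\mathsf K)$, and let $\mathcal L_{\mathcal F}$ be obtained by adding to $\mathcal L_{\mathsf K}$ one new function symbol, of the corresponding arity, for each entry of $\mathcal F$. Each $A\in\mathsf K$ on which all the operations in $\mathcal F$ are total expands to an $\mathcal L_{\mathcal F}$-algebra $A[\mathcal L_{\mathcal F}]$ by interpreting each new symbol as the corresponding $f^A$; $\mathsf K[\mathcal L_{\mathcal F}]$ is the class of the algebras so obtained. A \emph{pp expansion} of $\mathsf K$ is a class of the form $\mathbb S(\mathsf K[\mathcal L_{\mathcal F}])$, where $\mathbb S$ is closure under subalgebras; it is \emph{simple} when it is equal to $\mathsf K[\mathcal L_{\mathcal G}]$ for some family $\mathcal G$ of members of $\mathsf{ext}_{pp}(\mathsf K)$ (indexed by the symbols in its language that are not in $\mathcal L_{\mathsf K}$). Let $\mathsf M_1,\mathsf M_2$ be pp expansions of $\mathsf K$ with languages $\mathcal L_1,\mathcal L_2$. They are \emph{faithfully term equivalent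 relative to $\mathsf K$} when there are maps $\tau$, sending each $n$-ary symbol of $\mathcal L_1$ to an $\mathcal L_2$-term in the variables $x_1,\dots,x_n$, and $\rho$, sending each $n$-ary symbol of $\mathcal L_2$ to an $\mathcal L_1$-term in $x_1,\dots,x_n$, such that $\tau(f)=\rho(f)=f(x_1,\dots,x_n)$ for each $n$-ary $f\in\mathcal L_{\mathsf K}$, and for all $A\in\mathsf M_1$ and $B\in\mathsf M_2$: $\rho(A)\in\mathsf M_2$, $\tau(B)\in\mathsf M_1$, $\tau(\rho(A))=A$ and $\rho(\tau(B))=B$. Here $\rho(A)$ is the $\mathcal L_2$-algebra with the universe of $A$ in which each symbol $f$ is interpreted as the term operation $\rho(f)^A$, and $\tau(B)$ is defined analogously. \textbf{Theorem.} Let $\mathsf K$ be a quasivariety and let $\mathsf M_1,\mathsf M_2$ be pp expansions of $\mathsf K$ that are faithfully term equivalent relative to $\mathsf K$. Then $\mathsf M_1$ is simple if and only if $\mathsf M_2$ is simple. -/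

import Mathlib

open CategoryTheory
open scoped FirstOrder

universe u v

namespace PPExpansion

section Classes

variable {L : FirstOrder.Language.{u, v}}

/-- The direct product of a family of structures, with coordinatewise operations. -/
@[reducible]
def piStructure {ι : Type u} (A : ι → Type u) [∀ i, L.Structure (A i)] :
    L.Structure (∀ i, A i) where
  funMap f x := fun i => FirstOrder.Language.Structure.funMap f fun j => x j i
  RelMap r x := ∀ i, FirstOrder.Language.Structure.RelMap r fun j => x j i

/-- A quasivariety: a class of (nonempty) algebras closed under isomorphic copies, subalgebras,
direct products (the empty product included) and ultraproducts. -/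
structure IsQuasivariety (K : Set (Bundled.{u} L.Structure)) : Prop where
  nonempty : ∀ A ∈ K, Nonempty A
  iso_mem : ∀ A ∈ K, ∀ B : Bundled.{u} L.Structure, Nonempty (A ≃[L] B) → B ∈ K
  sub_mem : ∀ A ∈ K, ∀ S : L.Substructure A, (S : Set A).Nonempty →
    (⟨S, FirstOrder.Language.Substructure.inducedStructure⟩ : Bundled.{u} L.Structure) ∈ K
  prod_mem : ∀ (ι : Type u) (A : ι → Bundled.{u} L.Structure), (∀ i, A i ∈ K) →
    (⟨∀ i, A i, piStructure fun i => A i⟩ : Bundled.{u} L.Structure) ∈ K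
  ultraproduct_mem : ∀ (ι : Type u) (U : Ultrafilter ι) (A : ι → Bundled.{u} L.Structure),
    (∀ i, A i ∈ K) →
    (⟨(U : Filter ι).Product fun i => A i, FirstOrder.Language.Ultraproduct.structure⟩ :
      Bundled.{u} L.Structure) ∈ K

/-- The class of algebras that are (up to isomorphism) subalgebras of members of `C`. -/
def subalgebras (C : Set (Bundled.{u} L.Structure)) : Set (Bundled.{u} L.Structure) :=
  {A | Nonempty A ∧ ∃ B ∈ C, Nonempty (A ↪[L] B)}

/-- An `n`-ary operation of a class `K`: a family of partial `n`-ary functions on the members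
of `K` that is globally preserved by homomorphisms. -/
structure Operation (K : Set (Bundled.{u} L.Structure)) (n : ℕ) where
  /-- the partial function on a member of `K` -/
  app : ∀ A : Bundled.{u} L.Structure, A ∈ K → ((Fin n → A) →. A)
  /-- if `f(a)` is defined with value `b`, then `f(h(a))` is defined with value `h(b)` -/
  preserved : ∀ (A B : Bundled.{u} L.Structure) (hA : A ∈ K) (hB : B ∈ K) (h : A →[L] B)
    (a : Fin n → A) (b : A), b ∈ app A hA a → h b ∈ app B hB (h ∘ a)

/-- A pp formula: `∃ z₁ … zₖ`, a finite conjunction of equations. -/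
def IsPP {α : Type} (φ : L.Formula α) : Prop :=
  ∃ (k : ℕ) (E : List (L.Term (α ⊕ Fin k) × L.Term (α ⊕ Fin k))),
    φ = ((E.map fun e : L.Term (α ⊕ Fin k) × L.Term (α ⊕ Fin k) =>
      e.1.bdEqual e.2).foldr (· ⊓ ·) ⊤).exs

variable {K : Set (Bundled.{u} L.Structure)} {n : ℕ}

/-- The formula `φ(x₁, …, xₙ, y)` defines the graph of `f` on each member of `K`;
the variables `xᵢ` are indexed by `Fin n` and `y` by `Unit`. -/
def Operation.DefinedBy (f : Operation K n) (φ : L.Formula (Fin n ⊕ Unit)) : Prop :=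
  ∀ (A : Bundled.{u} L.Structure) (hA : A ∈ K) (a : Fin n → A) (b : A),
    φ.Realize (Sum.elim a fun _ => b) ↔ b ∈ f.app A hA a

/-- Implicit operations: operations of positive arity definable by a first order formula. -/
def Operation.IsImplicit (f : Operation K n) : Prop :=
  1 ≤ n ∧ ∃ φ : L.Formula (Fin n ⊕ Unit), f.DefinedBy φ

/-- `f` is extendable: every tuple of a member `A` of `K` lies in the domain of `f` in some
member of `K` extending `A`. -/
def Operation.IsExtendable (f : Operation K n) : Prop :=
  ∀ A ∈ K, ∀ a : Fin n → A, ∃ (B : Bundled.{u} L.Structure) (hB : B ∈ K) (i : A ↪[L] B),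
    (f.app B hB (i ∘ a)).Dom

variable (K n) in
/-- The `n`-ary pp definable extendable implicit operations of `K`. -/
def extPP : Set (Operation K n) :=
  {f | f.IsImplicit ∧ f.IsExtendable ∧ ∃ φ : L.Formula (Fin n ⊕ Unit), IsPP φ ∧ f.DefinedBy φ}

end Classes

section Expansions

variable {L : FirstOrder.Language.{u, v}}

/-- The `L`-reduct of an algebra in the language obtained by adding to `L` the symbols of `N`. -/
def reduct {N : FirstOrder.Language.{u, v}} (A : Bundled.{u} (L.sum N).Structure) :
    Bundled.{u} L.Structure :=
  ⟨A, (FirstOrder.Language.LHom.sumInl : FirstOrder.Language.LHom L (L.sum N)).reduct A⟩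

variable (K : Set (Bundled.{u} L.Structure)) {N : FirstOrder.Language.{u, v}}

/-- `K[L_F]`, where `F` assigns to each new symbol `g` in `N` a pp definable extendable implicit
operation of the same arity: the algebras whose `L`-reduct is a member of `K` on which all `F g`
are total, and in which each `g` is interpreted as `F g`. -/
def expansionClass (F : ∀ n, N.Functions n → extPP K n) :
    Set (Bundled.{u} (L.sum N).Structure) :=
  {A | ∃ hA : reduct A ∈ K, ∀ (n : ℕ) (g : N.Functions n) (a : Fin n → A),
    FirstOrder.Language.Structure.funMap (L := L.sum N) (Sum.inr g : (L.sum N).Functions n) a ∈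
      (F n g).1.app (reduct A) hA a}

/-- `M` is a pp expansion of `K`: it is of the form `S(K[L_F])`. -/
def IsPPExpansion (M : Set (Bundled.{u} (L.sum N).Structure)) : Prop :=
  ∃ F : ∀ n, N.Functions n → extPP K n, M = subalgebras (expansionClass K F)

/-- `M` is a simple pp expansion of `K`: a pp expansion of the form `K[L_F]`. -/
def IsSimplePPExpansion (M : Set (Bundled.{u} (L.sum N).Structure)) : Prop :=
  IsPPExpansion K M ∧ ∃ F : ∀ n, N.Functions n → extPP K n, M = expansionClass K F

end Expansions

section TermEquivalence

/-- An arity-preserving map from the function symbols of `L₁` to the terms of `L₂`: an `n`-ary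
symbol is sent to a term in the variables `x₁, …, xₙ`. -/
abbrev Translation (L₁ L₂ : FirstOrder.Language.{u, v}) : Type u :=
  ∀ n : ℕ, L₁.Functions n → L₂.Term (Fin n)

/-- The `L₁`-algebra `τ(B)` on the universe of the `L₂`-algebra `B`. -/
def Translation.apply {L₁ L₂ : FirstOrder.Language.{u, v}} [L₁.IsAlgebraic] (τ : Translation L₁ L₂)
    (B : Bundled.{u} L₂.Structure) : Bundled.{u} L₁.Structure :=
  ⟨B, { funMap := fun {n} f a => (τ n f).realize a
        RelMap := fun r => isEmptyElim r }⟩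

variable {L N₁ N₂ : FirstOrder.Language.{u, v}} [L.IsAlgebraic] [N₁.IsAlgebraic] [N₂.IsAlgebraic]

/-- `M₁` and `M₂` are faithfully term equivalent relative to the quasivariety whose language
is `L`. -/
def FaithfullyTermEquivalent (M₁ : Set (Bundled.{u} (L.sum N₁).Structure))
    (M₂ : Set (Bundled.{u} (L.sum N₂).Structure)) : Prop :=
  ∃ (τ : Translation (L.sum N₁) (L.sum N₂)) (ρ : Translation (L.sum N₂) (L.sum N₁)),
    (∀ (n : ℕ) (f : L.Functions n),
      τ n (Sum.inl f) = FirstOrder.Language.Functions.term (L := L.sum N₂) (Sum.inl f)) ∧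
    (∀ (n : ℕ) (f : L.Functions n),
      ρ n (Sum.inl f) = FirstOrder.Language.Functions.term (L := L.sum N₁) (Sum.inl f)) ∧
    (∀ A ∈ M₁, ρ.apply A ∈ M₂) ∧
    (∀ B ∈ M₂, τ.apply B ∈ M₁) ∧
    (∀ A ∈ M₁, τ.apply (ρ.apply A) = A) ∧
    (∀ B ∈ M₂, ρ.apply (τ.apply B) = B)

end TermEquivalence

end PPExpansion

/-! Let M₁ = K[L_F]. A term in the language of M₁ composes basic operations and members of F into a
partial operation on every algebra of K, preserved by homomorphisms. It is pp definable, because the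
intermediate values can be quantified existentially. It is extendable, because every member of K
embeds into one on which all of F is total (`exists_total_extension`), where every term has a value.
Hence the terms ρ(g), for g a new symbol of M₂, form a family G of members of ext_pp(K)
(`termOperation_mem_extPP`), and M₂ = K[L_G].

Indeed, if B ∈ M₂, then B = ρ(τ(B)) with τ(B) ∈ K[L_F], so g acts on B as G prescribes. Conversely,
if B ∈ K[L_G], its reduct embeds into the reduct of some C ∈ K[L_F]. Operations are preserved by
homomorphisms, so this map embeds B into ρ(C) ∈ M₂, and M₂, being a pp expansion, is closed under
subalgebras. -/

namespace PPExpansion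

open FirstOrder.Language FirstOrder.Language.Structure Filter

/-! ### Ultraproducts and direct limits in quasivarieties -/

section Quasivarieties

variable {L : FirstOrder.Language.{u, v}} {K : Set (Bundled.{u} L.Structure)}

/-- Quasivarieties are closed under structures that embed into a member. -/
theorem IsQuasivariety.mem_of_embedding (hK : IsQuasivariety K) {A B : Bundled.{u} L.Structure}
    (hB : B ∈ K) [Nonempty A] (i : A ↪[L] B) : A ∈ K := by
  refine hK.iso_mem _ (hK.sub_mem B hB i.toHom.range ?_) A ⟨i.equivRange.symm⟩
  exact ⟨i (Classical.arbitrary A), Set.mem_range_self _⟩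

/-- A family of maps that eventually respect the operations and eventually separate points
induces an embedding into the ultraproduct. -/
theorem exists_embedding_ultraproduct [L.IsAlgebraic] {ι : Type u} (U : Ultrafilter ι)
    {P : Type u} [L.Structure P] (C : ι → Type u) [∀ i, L.Structure (C i)]
    (g : ∀ i, P → C i)
    (hfun : ∀ (n : ℕ) (f : L.Functions n) (a : Fin n → P),
      ∀ᶠ i in (U : Filter ι), g i (funMap f a) = funMap f (g i ∘ a))
    (hinj : ∀ a b : P, a ≠ b → ∀ᶠ i in (U : Filter ι), g i a ≠ g i b) :
    ∃ e : P ↪[L] (U : Filter ι).Product C,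
      ∀ a, e a = ((fun i => g i a : ∀ i, C i) : (U : Filter ι).Product C) := by
  let h : P →[L] (U : Filter ι).Product C :=
    { toFun := fun a => ((fun i => g i a : ∀ i, C i) : (U : Filter ι).Product C)
      map_fun' := by
        intro n f a
        refine Eq.trans ?_ (Ultraproduct.funMap_cast (M := C) (u := U) f
          (fun k i => g i (a k))).symm
        exact Quotient.sound (hfun n f a)
      map_rel' := fun r => isEmptyElim r }
  have hh : Function.Injective h := by
    intro a b hab
    by_contra hne
    have h1 : ∀ᶠ i in (U : Filter ι), g i a = g i b := Quotient.exact hab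
    obtain ⟨i, hi, hi'⟩ := (h1.and (hinj a b hne)).exists
    exact hi' hi
  exact ⟨Embedding.ofInjective hh, fun a => rfl⟩

/-- The direct limit of a chain of members of a quasivariety is again a member. -/
theorem IsQuasivariety.directLimit_mem [L.IsAlgebraic] (hK : IsQuasivariety K)
    (X : ℕ → Bundled.{u} L.Structure) (hX : ∀ k, X k ∈ K) (f : ∀ i j, i ≤ j → X i ↪[L] X j)
    [DirectedSystem (fun i => X i) fun i j h => f i j h] :
    (⟨FirstOrder.Language.DirectLimit (fun i => X i) f, inferInstance⟩ : Bundled.{u} L.Structure) ∈ K := by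
  classical
  have : ∀ k, Nonempty (X k) := fun k => hK.nonempty _ (hX k)
  let o := fun i => DirectLimit.of L ℕ (fun i => X i) f i
  let U : Ultrafilter (ULift.{u} ℕ) := Ultrafilter.of atTop
  have hU : (U : Filter (ULift.{u} ℕ)) ≤ atTop := Ultrafilter.of_le atTop
  -- A left inverse of the canonical map of stage `i`, arbitrary off its image. Each point of the
  -- limit comes from all late stages, so the arbitrary values are invisible to `U`.
  let g : ∀ i : ULift.{u} ℕ, FirstOrder.Language.DirectLimit (fun i => X i) f → X i.down :=
    fun i => Function.invFun (o i.down)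
  have hg : ∀ x, ∀ᶠ i in (U : Filter (ULift.{u} ℕ)), o i.down (g i x) = x := by
    intro x
    obtain ⟨j, y, rfl⟩ := DirectLimit.exists_of x
    refine hU (mem_of_superset (mem_atTop (ULift.up j)) fun i hi => ?_)
    exact Function.invFun_eq ⟨f j i.down hi y, DirectLimit.of_f⟩
  obtain ⟨e, -⟩ := exists_embedding_ultraproduct (L := L) U (fun i : ULift.{u} ℕ => X i.down) g
    (fun n s a => by
      filter_upwards [hg (funMap s a), eventually_all.2 fun k => hg (a k)] with i h1 h2
      refine (o i.down).injective ?_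
      rw [h1, (o i.down).map_fun]
      exact congrArg (funMap s) (funext fun k => (h2 k).symm))
    (fun a b hab => by
      filter_upwards [hg a, hg b] with i h1 h2 h
      exact hab (by rw [← h1, ← h2, h]))
  have : Nonempty (FirstOrder.Language.DirectLimit (fun i => X i) f) := ⟨o 0 (Classical.arbitrary _)⟩
  exact hK.mem_of_embedding (A := ⟨FirstOrder.Language.DirectLimit (fun i => X i) f, inferInstance⟩)
    (hK.ultraproduct_mem _ U (fun i => X i.down) fun i => hX _) e

end Quasivarieties

/-! ### Closure properties of pp definable relations -/

section PrimitivePositive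

variable {L : FirstOrder.Language.{u, v}}

theorem realize_iff_of_isPP_form {α : Type} {k : ℕ}
    (E : List (L.Term (α ⊕ Fin k) × L.Term (α ⊕ Fin k))) {A : Type u} [L.Structure A]
    (v : α → A) :
    Formula.Realize (((E.map fun e : L.Term (α ⊕ Fin k) × L.Term (α ⊕ Fin k) =>
      e.1.bdEqual e.2).foldr (· ⊓ ·) ⊤).exs) v ↔
      ∃ z : Fin k → A, ∀ e ∈ E, e.1.realize (Sum.elim v z) = e.2.realize (Sum.elim v z) := by
  simp only [BoundedFormula.realize_exs, BoundedFormula.realize_foldr_inf, List.forall_mem_map,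
    BoundedFormula.realize_bdEqual]

variable (K : Set (Bundled.{u} L.Structure))

/-- A relation on the members of `K` that is the projection of the solution set of a finite
system of equations, the auxiliary unknowns being indexed by an arbitrary finite type. -/
def PPDefinable {α : Type} (R : ∀ A ∈ K, (α → A) → Prop) : Prop :=
  ∃ (β : Type) (_ : Finite β) (E : List (L.Term (α ⊕ β) × L.Term (α ⊕ β))),
    ∀ (A : Bundled.{u} L.Structure) (hA : A ∈ K) (v : α → A), R A hA v ↔
      ∃ z : β → A, ∀ e ∈ E, e.1.realize (Sum.elim v z) = e.2.realize (Sum.elim v z)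

variable {K} {α : Type}

theorem PPDefinable.congr {R S : ∀ A ∈ K, (α → A) → Prop} (hR : PPDefinable K R)
    (h : ∀ A hA v, S A hA v ↔ R A hA v) : PPDefinable K S := by
  obtain ⟨β, hβ, E, hE⟩ := hR
  exact ⟨β, hβ, E, fun A hA v => (h A hA v).trans (hE A hA v)⟩

theorem PPDefinable.of_isPP {φ : L.Formula α} (hφ : IsPP φ) :
    PPDefinable K fun A _ v => φ.Realize (M := A) v := by
  obtain ⟨k, E, rfl⟩ := hφ
  exact ⟨Fin k, inferInstance, E, fun A _ v => realize_iff_of_isPP_form E v⟩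

theorem PPDefinable.eq (s t : L.Term α) :
    PPDefinable K fun A _ v => s.realize (M := A) v = t.realize v :=
  ⟨Empty, inferInstance, [(s.relabel Sum.inl, t.relabel Sum.inl)], fun A _ v => by
    simp [Term.realize_relabel, Function.comp_def]⟩

theorem PPDefinable.comap {β : Type} {R : ∀ A ∈ K, (α → A) → Prop} (hR : PPDefinable K R)
    (g : α → β) : PPDefinable K fun A hA (v : β → A) => R A hA (v ∘ g) := by
  obtain ⟨γ, hγ, E, hE⟩ := hR
  refine ⟨γ, hγ, E.map fun e => (e.1.relabel (Sum.map g id), e.2.relabel (Sum.map g id)),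
    fun A hA v => ?_⟩
  simp only [hE, List.forall_mem_map, Term.realize_relabel, Sum.elim_comp_map, Function.comp_id]

/-- The systems are placed side by side with disjoint unknowns, so the existential quantifiers move
in front of the conjunction. -/
theorem PPDefinable.all {γ : Type} [Finite γ] {R : γ → ∀ A ∈ K, (α → A) → Prop}
    (hR : ∀ j, PPDefinable K (R j)) : PPDefinable K fun A hA v => ∀ j, R j A hA v := by
  choose β hβ E hE using hR
  have := Fintype.ofFinite γ
  refine ⟨Σ j, β j, inferInstance, Finset.univ.toList.flatMap fun j => (E j).map fun e =>
    (e.1.relabel (Sum.map id (Sigma.mk j)), e.2.relabel (Sum.map id (Sigma.mk j))),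
    fun A hA v => ?_⟩
  simp only [hE, List.mem_flatMap, List.mem_map, Finset.mem_toList, Finset.mem_univ, true_and]
  constructor
  · intro h
    choose z hz using h
    refine ⟨fun p => z p.1 p.2, ?_⟩
    rintro _ ⟨j, e, he, rfl⟩
    simp only [Term.realize_relabel, Sum.elim_comp_map]
    exact hz j e he
  · rintro ⟨z, hz⟩ j
    refine ⟨fun b => z ⟨j, b⟩, fun e he => ?_⟩
    have := hz _ ⟨j, e, he, rfl⟩
    simp only [Term.realize_relabel, Sum.elim_comp_map] at this
    exact this

theorem PPDefinable.and {R S : ∀ A ∈ K, (α → A) → Prop} (hR : PPDefinable K R)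
    (hS : PPDefinable K S) : PPDefinable K fun A hA v => R A hA v ∧ S A hA v :=
  (PPDefinable.all (γ := Bool) (R := fun b => bif b then R else S)
    (by rintro (_ | _) <;> assumption)).congr fun A hA v => by simp [and_comm]

theorem PPDefinable.ex {γ : Type} [Finite γ] {R : ∀ A ∈ K, (α ⊕ γ → A) → Prop}
    (hR : PPDefinable K R) : PPDefinable K fun A hA v => ∃ c : γ → A, R A hA (Sum.elim v c) := by
  obtain ⟨β, hβ, E, hE⟩ := hR
  refine ⟨γ ⊕ β, inferInstance, E.map fun e =>
    (e.1.relabel (Equiv.sumAssoc α γ β), e.2.relabel (Equiv.sumAssoc α γ β)), fun A hA v => ?_⟩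
  have key : ∀ (c : γ → A) (z : β → A),
      Sum.elim v (Sum.elim c z) ∘ Equiv.sumAssoc α γ β = Sum.elim (Sum.elim v c) z := by
    intro c z
    ext ((_ | _) | _) <;> rfl
  simp only [hE, List.forall_mem_map, Term.realize_relabel]
  constructor
  · rintro ⟨c, z, h⟩
    exact ⟨Sum.elim c z, by simpa only [key] using h⟩
  · rintro ⟨z, h⟩
    refine ⟨z ∘ Sum.inl, z ∘ Sum.inr, ?_⟩
    simpa only [← key, Sum.elim_comp_inl_inr] using h

theorem PPDefinable.exists_isPP {R : ∀ A ∈ K, (α → A) → Prop} (hR : PPDefinable K R) :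
    ∃ φ : L.Formula α, IsPP φ ∧
      ∀ (A : Bundled.{u} L.Structure) (hA : A ∈ K) (v : α → A), φ.Realize v ↔ R A hA v := by
  obtain ⟨β, hβ, E, hE⟩ := hR
  obtain ⟨k, ⟨e⟩⟩ := Finite.exists_equiv_fin β
  refine ⟨_, ⟨k, E.map fun p =>
    (p.1.relabel (Sum.map id e), p.2.relabel (Sum.map id e)), rfl⟩, fun A hA v => ?_⟩
  rw [realize_iff_of_isPP_form, hE]
  simp only [List.forall_mem_map, Term.realize_relabel, Sum.elim_comp_map, Function.comp_id]
  constructor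
  · rintro ⟨z, h⟩
    exact ⟨z ∘ e, h⟩
  · rintro ⟨z, h⟩
    exact ⟨z ∘ e.symm, by simpa [Function.comp_assoc] using h⟩

end PrimitivePositive

/-! ### Extensions on which the operations are total -/

section Total

variable {L N : FirstOrder.Language.{u, v}} {K : Set (Bundled.{u} L.Structure)}

/-- Values obtained at one stage therefore survive every later extension. -/
theorem Operation.dom_map {n : ℕ} (f : Operation K n) {A B : Bundled.{u} L.Structure}
    (hA : A ∈ K) (hB : B ∈ K) (h : A →[L] B) {a : Fin n → A} (ha : (f.app A hA a).Dom) :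
    (f.app B hB (h ∘ a)).Dom :=
  Part.dom_iff_mem.2 ⟨_, f.preserved A B hA hB h a _ (Part.get_mem ha)⟩

/-- Finitely many values of extendable operations exist in a common extension. -/
theorem exists_extension_finset (F : ∀ n, N.Functions n → extPP K n)
    {A : Bundled.{u} L.Structure} (hA : A ∈ K)
    (s : Finset (Σ n, N.Functions n × (Fin n → A))) :
    ∃ (B : Bundled.{u} L.Structure) (hB : B ∈ K) (i : A ↪[L] B),
      ∀ p ∈ s, ((F p.1 p.2.1).1.app B hB (i ∘ p.2.2)).Dom := by
  classical
  induction s using Finset.induction_on with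
  | empty => exact ⟨A, hA, Embedding.refl L A, by simp⟩
  | insert p s _ ih =>
    obtain ⟨B, hB, i, hi⟩ := ih
    obtain ⟨C, hC, j, hj⟩ := (F p.1 p.2.1).2.2.1 B hB (i ∘ p.2.2)
    refine ⟨C, hC, j.comp i, fun q hq => ?_⟩
    rcases Finset.mem_insert.1 hq with rfl | hq
    · exact hj
    · exact Operation.dom_map _ hB hC j.toHom (hi q hq)

/-- All values of the operations in `F` at tuples of `A` exist in a common extension. -/
theorem exists_extension_forall_dom [L.IsAlgebraic] (hK : IsQuasivariety K)
    (F : ∀ n, N.Functions n → extPP K n) {A : Bundled.{u} L.Structure} (hA : A ∈ K) :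
    ∃ (B : Bundled.{u} L.Structure) (hB : B ∈ K) (i : A ↪[L] B),
      ∀ n (g : N.Functions n) (a : Fin n → A), ((F n g).1.app B hB (i ∘ a)).Dom := by
  classical
  choose C hC j hj using exists_extension_finset F hA
  -- Refining `atTop` makes the finite sets containing any given triple `⟨n, g, a⟩` a set in `U`.
  let U : Ultrafilter (Finset (Σ n, N.Functions n × (Fin n → A))) := Ultrafilter.of atTop
  have hU : (U : Filter (Finset (Σ n, N.Functions n × (Fin n → A)))) ≤ atTop := Ultrafilter.of_le atTop
  have : ∀ s, Nonempty (C s) := fun s => hK.nonempty _ (hC s)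
  obtain ⟨e, he⟩ := exists_embedding_ultraproduct U (fun s => C s) (fun s => j s)
    (fun n f a => Eventually.of_forall fun s => (j s).map_fun f a)
    (fun a b hab => Eventually.of_forall fun s => (j s).injective.ne hab)
  have hP := hK.ultraproduct_mem _ U C hC
  refine ⟨_, hP, e, fun n g a => ?_⟩
  obtain ⟨φ, hφ⟩ := (F n g).2.1.2
  -- The value is arbitrary only on a `U`-null set of indices. By Łoś's theorem, applied to the
  -- formula defining the operation, `b` represents the value in the ultraproduct.
  let b : ∀ s, C s := fun s =>
    if h : ((F n g).1.app (C s) (hC s) (j s ∘ a)).Dom then Part.get _ h else Classical.arbitrary _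
  refine Part.dom_iff_mem.2 ⟨(b : (U : Filter _).Product fun s => C s), (hφ _ hP _ _).1 ?_⟩
  have := (Ultraproduct.realize_formula_cast (M := fun s => C s) (u := U) φ
    (Sum.elim (fun k s => j s (a k)) fun _ => b)).2 (by
      refine hU (mem_of_superset (mem_atTop {⟨n, g, a⟩}) fun s hs => ?_)
      have hd := hj s ⟨n, g, a⟩ (Finset.singleton_subset_iff.1 hs)
      have hb : b s ∈ (F n g).1.app (C s) (hC s) (j s ∘ a) := by
        simp only [b, dif_pos hd]
        exact Part.get_mem hd
      have := (hφ _ (hC s) _ _).2 hb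
      refine (congrArg (fun v => φ.Realize (M := C s) v) ?_).mp this
      ext (_ | _) <;> rfl)
  refine (congrArg (fun v => φ.Realize (M := (U : Filter _).Product fun s => C s) v) ?_).mp this
  funext k
  rcases k with k | _
  · exact (he (a k)).symm
  · rfl

/-- Every member of `K` embeds into a member on which all operations in `F` are total. -/
theorem exists_total_extension [L.IsAlgebraic] (hK : IsQuasivariety K)
    (F : ∀ n, N.Functions n → extPP K n) {A : Bundled.{u} L.Structure} (hA : A ∈ K) :
    ∃ (B : Bundled.{u} L.Structure) (hB : B ∈ K) (_ : A ↪[L] B),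
      ∀ n (g : N.Functions n) (b : Fin n → B), ((F n g).1.app B hB b).Dom := by
  have step : ∀ A : K, ∃ (B : K) (i : A.1 ↪[L] B.1),
      ∀ n (g : N.Functions n) (a : Fin n → A.1), ((F n g).1.app B.1 B.2 (i ∘ a)).Dom := by
    intro A
    obtain ⟨B, hB, i, hi⟩ := exists_extension_forall_dom hK F A.2
    exact ⟨⟨B, hB⟩, i, hi⟩
  choose next emb hemb using step
  let X : ℕ → K := fun k => Nat.rec ⟨A, hA⟩ (fun _ => next) k
  let f' : ∀ k, (X k).1 ↪[L] (X (k + 1)).1 := fun k => emb (X k)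
  let f := DirectedSystem.natLERec (G' := fun k => (X k).1) f'
  let o := fun i => DirectLimit.of L ℕ (fun k => (X k).1) f i
  have hB := hK.directLimit_mem (fun k => (X k).1) (fun k => (X k).2) f
  refine ⟨_, hB, o 0, fun n g b => ?_⟩
  -- A finite tuple of the limit lives at some stage `k`; the operation is defined on it at stage `k
  -- + 1`, hence in the limit.
  obtain ⟨k, a, hka⟩ := DirectLimit.exists_quotient_mk'_sigma_mk'_eq (fun k => (X k).1) f b
  have hb : b = o (k + 1) ∘ (f' k ∘ a) := by
    rw [hka]
    funext m
    have h1 : f k (k + 1) (Nat.le_succ k) (a m) = f' k (a m) := by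
      simp [f, Nat.leRecOn_succ']
    exact (DirectLimit.of_f (f := f) (hij := Nat.le_succ k) (x := a m)).symm.trans
      (congrArg (o (k + 1)) h1)
  rw [hb]
  exact Operation.dom_map _ (X (k + 1)).2 hB (o (k + 1)).toHom (hemb (X k) n g a)

end Total

/-! ### Terms as compositions of partial operations -/

section Evaluation

variable {L N : FirstOrder.Language.{u, v}} {K : Set (Bundled.{u} L.Structure)}

/-- The graph of the (possibly partial) interpretation of a symbol of the expanded language. -/
def SymbolGraph (F : ∀ n, N.Functions n → extPP K n) (A : Bundled.{u} L.Structure) (hA : A ∈ K)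
    {n : ℕ} (f : (L.sum N).Functions n) (c : Fin n → A) (b : A) : Prop :=
  match f with
  | Sum.inl f => funMap f c = b
  | Sum.inr g => b ∈ (F n g).1.app A hA c

/-- The graph of the partial function obtained by composing the operations in `F` and the basic
operations of `A` as prescribed by a term. -/
def Evaluates (F : ∀ n, N.Functions n → extPP K n) (A : Bundled.{u} L.Structure) (hA : A ∈ K)
    {α : Type} (a : α → A) : (L.sum N).Term α → A → Prop
  | .var i, b => a i = b
  | .func f ts, b => ∃ c, (∀ j, Evaluates F A hA a (ts j) (c j)) ∧ SymbolGraph F A hA f c b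

variable (F : ∀ n, N.Functions n → extPP K n) {α : Type}

theorem SymbolGraph.unique {A : Bundled.{u} L.Structure} {hA : A ∈ K} {n : ℕ}
    {f : (L.sum N).Functions n} {c : Fin n → A} {b b' : A} (h : SymbolGraph F A hA f c b)
    (h' : SymbolGraph F A hA f c b') : b = b' := by
  rcases f with f | g
  · exact Eq.trans (Eq.symm h) h'
  · exact Part.mem_unique h h'

theorem SymbolGraph.map {A B : Bundled.{u} L.Structure} {hA : A ∈ K} (hB : B ∈ K) (h : A →[L] B)
    {n : ℕ} {f : (L.sum N).Functions n} {c : Fin n → A} {b : A} (hb : SymbolGraph F A hA f c b) :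
    SymbolGraph F B hB f (h ∘ c) (h b) := by
  rcases f with f | g
  · exact (h.map_fun f c).symm.trans (congrArg h hb)
  · exact (F n g).1.preserved A B hA hB h c b hb

theorem SymbolGraph.ppDefinable {n : ℕ} (f : (L.sum N).Functions n) :
    PPDefinable K fun A hA (v : Fin n ⊕ Unit → A) =>
      SymbolGraph F A hA f (v ∘ Sum.inl) (v (Sum.inr ())) := by
  rcases f with f | g
  · refine (PPDefinable.eq (.func f fun j => .var (Sum.inl j)) (.var (Sum.inr ()))).congr
      fun A hA v => Iff.rfl
  · obtain ⟨φ, hφ, hd⟩ := (F n g).2.2.2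
    refine (PPDefinable.of_isPP hφ).congr fun A hA v => ?_
    refine (hd A hA _ _).symm.trans ?_
    rw [show Sum.elim (v ∘ Sum.inl) (fun _ => v (Sum.inr ())) = v by ext (_ | _) <;> rfl]

theorem Evaluates.unique {A : Bundled.{u} L.Structure} {hA : A ∈ K} {a : α → A}
    {t : (L.sum N).Term α} {b b' : A} (h : Evaluates F A hA a t b)
    (h' : Evaluates F A hA a t b') : b = b' := by
  induction t generalizing b b' with
  | var i => exact Eq.trans (Eq.symm h) h'
  | func f ts ih =>
    obtain ⟨c, hc, hb⟩ := h
    obtain ⟨c', hc', hb'⟩ := h'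
    obtain rfl : c = c' := funext fun j => ih j (hc j) (hc' j)
    exact hb.unique F hb'

theorem Evaluates.map {A B : Bundled.{u} L.Structure} {hA : A ∈ K} (hB : B ∈ K) (h : A →[L] B)
    {a : α → A} {t : (L.sum N).Term α} {b : A} (hb : Evaluates F A hA a t b) :
    Evaluates F B hB (h ∘ a) t (h b) := by
  induction t generalizing b with
  | var i => exact congrArg h hb
  | func f ts ih =>
    obtain ⟨c, hc, hb⟩ := hb
    exact ⟨h ∘ c, fun j => ih j (hc j), hb.map F hB h⟩

/-- Induction on the term: the values of the immediate subterms become existentially quantified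
unknowns, joined to the graph of the head symbol. -/
theorem Evaluates.ppDefinable (t : (L.sum N).Term α) :
    PPDefinable K fun A hA (v : α ⊕ Unit → A) =>
      Evaluates F A hA (v ∘ Sum.inl) t (v (Sum.inr ())) := by
  induction t with
  | var i =>
    exact (PPDefinable.eq (.var (Sum.inl i)) (.var (Sum.inr ()))).congr fun A hA v => Iff.rfl
  | @func n f ts ih =>
    have h1 := PPDefinable.all fun j : Fin n =>
      (ih j).comap (Sum.elim (Sum.inl ∘ Sum.inl) fun _ => Sum.inr j :
        α ⊕ Unit → (α ⊕ Unit) ⊕ Fin n)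
    have h2 := (SymbolGraph.ppDefinable F f).comap
      (Sum.elim Sum.inr fun _ => Sum.inl (Sum.inr ()) : Fin n ⊕ Unit → (α ⊕ Unit) ⊕ Fin n)
    exact (h1.and h2).ex.congr fun A hA v => Iff.rfl

theorem symbolGraph_funMap {A : Bundled.{u} (L.sum N).Structure}
    (hA : reduct A ∈ K) (h : ∀ (n : ℕ) (g : N.Functions n) (a : Fin n → A),
      funMap (L := L.sum N) (Sum.inr g : (L.sum N).Functions n) a ∈
        (F n g).1.app (reduct A) hA a) {n : ℕ} (f : (L.sum N).Functions n) (c : Fin n → A) :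
    SymbolGraph F (reduct A) hA f c (funMap (M := A) f c) := by
  rcases f with f | g
  · rfl
  · exact h n g c

/-- In the algebras of `K[L_F]`, terms are evaluated by composing operations in `F`. -/
theorem evaluates_realize {A : Bundled.{u} (L.sum N).Structure}
    (hA : reduct A ∈ K) (h : ∀ (n : ℕ) (g : N.Functions n) (a : Fin n → A),
      funMap (L := L.sum N) (Sum.inr g : (L.sum N).Functions n) a ∈
        (F n g).1.app (reduct A) hA a) (a : α → A) (t : (L.sum N).Term α) :
    Evaluates F (reduct A) hA a t (t.realize (M := A) a) := by
  induction t with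
  | var i => rfl
  | func f ts ih => exact ⟨_, ih, symbolGraph_funMap F hA h f _⟩

/-- Every member of `K` embeds into the reduct of a member of `K[L_F]`. -/
theorem exists_embedding_reduct [L.IsAlgebraic] [N.IsAlgebraic] (hK : IsQuasivariety K)
    {A : Bundled.{u} L.Structure} (hA : A ∈ K) :
    ∃ C ∈ expansionClass K F, Nonempty (A ↪[L] reduct C) := by
  obtain ⟨B, hB, i, hi⟩ := exists_total_extension hK F hA
  refine ⟨⟨B, { funMap := fun {n} f b => Sum.casesOn f (fun f => funMap f b)
                  (fun g => ((F n g).1.app B hB b).get (hi n g b))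
                RelMap := fun r => Sum.casesOn r (fun r => RelMap r) (fun r => isEmptyElim r) }⟩,
    ⟨hB, fun n g b => Part.get_mem _⟩, ⟨i⟩⟩

/-- The operation of `K` obtained by composing operations in `F` as prescribed by a term. -/
noncomputable def termOperation {n : ℕ} (t : (L.sum N).Term (Fin n)) : Operation K n where
  -- The choice of value is harmless by `Evaluates.unique`.
  app A hA a := ⟨∃ b, Evaluates F A hA a t b, fun h => h.choose⟩
  preserved A B hA hB h a b := by
    rintro ⟨hd, rfl⟩
    have hm := Evaluates.map F hB h hd.choose_spec
    exact ⟨⟨_, hm⟩, Evaluates.unique F (Exists.choose_spec ⟨_, hm⟩) hm⟩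

theorem mem_termOperation {n : ℕ} (t : (L.sum N).Term (Fin n)) {A : Bundled.{u} L.Structure}
    {hA : A ∈ K} {a : Fin n → A} {b : A} :
    b ∈ (termOperation F t).app A hA a ↔ Evaluates F A hA a t b := by
  constructor
  · rintro ⟨hd, rfl⟩
    exact hd.choose_spec
  · intro h
    exact ⟨⟨_, h⟩, Evaluates.unique F (Exists.choose_spec ⟨_, h⟩) h⟩

/-- For extendability, pass to an extension in K[L_F], where the term is total. -/
theorem termOperation_mem_extPP [L.IsAlgebraic] [N.IsAlgebraic] (hK : IsQuasivariety K) {n : ℕ}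
    (hn : 1 ≤ n) (t : (L.sum N).Term (Fin n)) : termOperation F t ∈ extPP K n := by
  obtain ⟨φ, hφ, h⟩ := (Evaluates.ppDefinable F t).exists_isPP
  have hd : (termOperation F t).DefinedBy φ := fun A hA a b =>
    (h A hA _).trans (mem_termOperation F t).symm
  refine ⟨⟨hn, φ, hd⟩, fun A hA a => ?_, φ, hφ, hd⟩
  obtain ⟨C, ⟨hC, hF⟩, ⟨i⟩⟩ := exists_embedding_reduct F hK hA
  exact ⟨reduct C, hC, i, _, evaluates_realize F hC hF (i ∘ a) t⟩

end Evaluation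

/-! ### Transfer of simplicity along a term equivalence -/

section Transfer

variable {L N₁ N₂ : FirstOrder.Language.{u, v}} [L.IsAlgebraic] [N₁.IsAlgebraic] [N₂.IsAlgebraic]
  {K : Set (Bundled.{u} L.Structure)}
  {M₁ : Set (Bundled.{u} (L.sum N₁).Structure)} {M₂ : Set (Bundled.{u} (L.sum N₂).Structure)}

theorem FaithfullyTermEquivalent.symm (h : FaithfullyTermEquivalent M₁ M₂) :
    FaithfullyTermEquivalent M₂ M₁ := by
  obtain ⟨τ, ρ, h1, h2, h3, h4, h5, h6⟩ := h
  exact ⟨ρ, τ, h2, h1, h4, h3, h6, h5⟩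

/-- A translation fixing the symbols of `L` does not change the `L`-reduct. -/
def reductEquivReductApply (ρ : Translation (L.sum N₂) (L.sum N₁))
    (hρ : ∀ (n : ℕ) (f : L.Functions n),
      ρ n (Sum.inl f) = FirstOrder.Language.Functions.term (L := L.sum N₁) (Sum.inl f))
    (A : Bundled.{u} (L.sum N₁).Structure) : reduct A ≃[L] reduct (ρ.apply A) where
  toEquiv := _root_.Equiv.refl A
  map_fun' {n} f a := by
    change funMap (L := L.sum N₁) (M := A) (Sum.inl f : (L.sum N₁).Functions n) a =
      (ρ n (Sum.inl f)).realize (M := A) a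
    rw [hρ]
    exact (Term.realize_function_term (L := L.sum N₁) (M := A) a (Sum.inl f : (L.sum N₁).Functions n)).symm
  map_rel' r := isEmptyElim r

theorem IsSimplePPExpansion.of_faithfullyTermEquivalent (hK : IsQuasivariety K)
    (hM₂ : IsPPExpansion K M₂) (h : FaithfullyTermEquivalent M₁ M₂)
    (hs : IsSimplePPExpansion K M₁) : IsSimplePPExpansion K M₂ := by
  refine ⟨hM₂, ?_⟩
  obtain ⟨F₂, hF₂⟩ := hM₂
  obtain ⟨-, F, rfl⟩ := hs
  obtain ⟨τ, ρ, -, hρ, hρM, hτM, -, hρτ⟩ := h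
  let G : ∀ n, N₂.Functions n → extPP K n := fun n g =>
    -- The arity is positive because `g` also names an implicit operation of the family `F₂`
    -- witnessing that `M₂` is a pp expansion.
    ⟨termOperation F (ρ n (Sum.inr g)), termOperation_mem_extPP F hK (F₂ n g).2.1.1 _⟩
  refine ⟨G, Set.Subset.antisymm ?_ ?_⟩
  · intro B hB
    rw [← hρτ B hB]
    obtain ⟨hA, hF⟩ := hτM B hB
    let e := reductEquivReductApply ρ hρ (τ.apply B)
    refine ⟨hK.iso_mem _ hA _ ⟨e⟩, fun n g a => ?_⟩
    -- The term is evaluated in the reduct of τ(B), and its value is carried to the reduct of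
    -- ρ(τ(B)) by the identity isomorphism.
    exact (G n g).1.preserved _ _ hA _ e.toHom a _
      ((mem_termOperation F _).2 (evaluates_realize F hA hF a (ρ n (Sum.inr g))))
  · rintro B ⟨hA, hG⟩
    obtain ⟨C, hC, ⟨i⟩⟩ := exists_embedding_reduct F hK hA
    let k : B →[L.sum N₂] ρ.apply C :=
      { toFun := i
        map_fun' := by
          rintro n (f | g) a
          · refine (i.map_fun f a).trans ?_
            change _ = (ρ n (Sum.inl f)).realize (M := C) (i ∘ a)
            rw [hρ]
            exact (Term.realize_function_term (L := L.sum N₁) (M := C) _ (Sum.inl f : (L.sum N₁).Functions n)).symm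
          -- The image of the value in `B` and the value of ρ(g) in `C` both evaluate the same term
          -- at the same tuple, so they coincide.
          · have h1 := (mem_termOperation F (ρ n (Sum.inr g))).1 (hG n g a)
            exact Evaluates.unique F (h1.map F hC.1 i.toHom)
              (evaluates_realize F hC.1 hC.2 (i ∘ a) _)
        map_rel' := fun r => isEmptyElim r }
    have hk : Function.Injective k := i.injective
    have hmem := hρM C hC
    rw [hF₂] at hmem ⊢
    obtain ⟨-, D, hD, ⟨j⟩⟩ := hmem
    exact ⟨hK.nonempty _ hA, D, hD, ⟨j.comp (Embedding.ofInjective hk)⟩⟩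

end Transfer

end PPExpansion

theorem mainTheorem4 {L N₁ N₂ : FirstOrder.Language.{u, v}}
    [L.IsAlgebraic] [N₁.IsAlgebraic] [N₂.IsAlgebraic]
    (K : Set (CategoryTheory.Bundled.{u} L.Structure)) (hK : PPExpansion.IsQuasivariety K)
    (M₁ : Set (CategoryTheory.Bundled.{u} (L.sum N₁).Structure))
    (M₂ : Set (CategoryTheory.Bundled.{u} (L.sum N₂).Structure))
    (hM₁ : PPExpansion.IsPPExpansion K M₁) (hM₂ : PPExpansion.IsPPExpansion K M₂)
    (h : PPExpansion.FaithfullyTermEquivalent M₁ M₂) :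
    PPExpansion.IsSimplePPExpansion K M₁ ↔ PPExpansion.IsSimplePPExpansion K M₂ := by
  exact ⟨.of_faithfullyTermEquivalent hK hM₂ h, .of_faithfullyTermEquivalent hK hM₁ h.symm⟩
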